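/- Let $(H,G)$ be a crossed module of topological groups: topological groups $H$ and $G$, a continuous homomorphism $t\colon G\to H$ and a continuous action $\alpha$ of $H$ on $G$ by automorphisms such that $t(\alpha(h)(g)) = h\,t(g)\,h^{-1}$ and $\alpha(t(g))(g') = g g' g^{-1}$ for all $h\in H$, $g,g'\in G$. Assume that the projections $G\to G/\ker t$ and $H\to H/t(G)$ admit local sections, and that $t$ induces a homeomorphism of $G/\ker t$ onto the subspace $t(G)$ of $H$. An $(H,G)$ bibundle on a space $M$ is a (locally trivial) right principal $G$ bundle $P\to M$ together with a continuous structure map $\psi\colon P\to H$ satisfying $\psi(pg)=\psi(p)t(g)$. An isomorphism of bibundles on $M$ is a $G$-equivariant homeomorphism of total spaces over $M$ that commutes with the structure maps. The type map of $P$ is the continuous map $\phi\colon M\to H/t(G)$ that sends $m$ to the coset $\psi(p)t(G)$, for any $p$ in the fibre of $P$ over $m$. For a continuous map $f\colon N\to M$, the pullback $f^*P=N\times_M P$ is an $(H,G)$ bibundle on $N$. **Theorem.** Let $E\to B$ be an $(H,G)$ bibundle with structure map $\psi\colon E\to H$ and type map $\phi\colon B\to H/t(G)$. Suppose that $E$ is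 contractible as a space over $H$, that is, $\psi$ is a homotopy equivalence over $H$ from $(E,\psi)$ to $(H,\mathrm{id}_H)$. For a space $M$, let $[M,B]_{H/t(G)}$ be the set of continuous maps $f\colon M\to B$ modulo homotopy over $H/t(G)$: $f_0$ and $f_1$ are identified if there is a homotopy $h\colon M\times[0,1]\to B$ from $f_0$ to $f_1$ such that $\phi(h(x,s))=\phi(f_0(x))$ for all $x\in M$ and $s\in[0,1]$. Then for every paracompact Hausdorff space $M$ the assignment $[f]\mapsto[f^*E]$ is a well-defined bijection from $[M,B]_{H/t(G)}$ onto the set of isomorphism classes of $(H,G)$ bibundles on $M$. -/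

import Mathlib

universe uH uG uM uB uE u v w

/-- A crossed module of topological groups `G --t--> H --α--> Aut(G)`: `t` is a continuous
homomorphism, `H` acts continuously on `G` by automorphisms through `α`, `t` is `H`-equivariant for
the conjugation action of `H` on itself, and `α ∘ t` is the conjugation action of `G` on itself. -/
structure TopCrossedModule (H : Type*) (G : Type*) [Group H] [TopologicalSpace H]
    [IsTopologicalGroup H] [Group G] [TopologicalSpace G] [IsTopologicalGroup G] where
  t : G →* H
  α : H →* MulAut G
  continuous_t : Continuous t
  continuous_α : Continuous fun x : H × G => α x.1 x.2
  t_α : ∀ (h : H) (g : G), t (α h g) = h * t g * h⁻¹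
  α_t : ∀ g g' : G, α (t g) g' = g * g' * g⁻¹

/-- A map admits local sections if every point of its target has an open neighbourhood on which the
map has a continuous section. -/
def HasLocalSections {X Y : Type*} [TopologicalSpace X] [TopologicalSpace Y] (p : X → Y) : Prop :=
  ∀ y : Y, ∃ U : Set Y, IsOpen U ∧ y ∈ U ∧ ∃ s : C(U, X), ∀ u : U, p (s u) = u

/-- Two maps `f₀ f₁ : X → Y` are homotopic over `S`, where `Y` is a space over `S` by `q`: there is a
homotopy from `f₀` to `f₁` all of whose stages have the same composite with `q`. In other words `X`
is a space over `S` by `q ∘ f₀ = q ∘ f₁`, and every stage of the homotopy is a map over `S`. -/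
def HomotopicOver {X Y S : Type*} [TopologicalSpace X] [TopologicalSpace Y] (q : Y → S)
    (f₀ f₁ : C(X, Y)) : Prop :=
  ContinuousMap.HomotopicWith f₀ f₁ fun f => ∀ x, q (f x) = q (f₀ x)

theorem HomotopicOver.map_eq {X Y S : Type*} [TopologicalSpace X] [TopologicalSpace Y] {q : Y → S}
    {f₀ f₁ : C(X, Y)} (h : HomotopicOver q f₀ f₁) (x : X) : q (f₁ x) = q (f₀ x) := by
  obtain ⟨F⟩ := h
  have h1 := F.prop 1 x
  simpa using h1

/-- Homotopy over `S` is an equivalence relation on the continuous maps `X → Y`. -/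
def homotopicOverSetoid (X : Type*) {Y S : Type*} [TopologicalSpace X] [TopologicalSpace Y]
    (q : Y → S) : Setoid C(X, Y) where
  r := HomotopicOver q
  iseqv :=
    { refl := fun f => ContinuousMap.HomotopicWith.refl f fun _ => rfl
      symm := fun {f₀ f₁} h => by
        have e : (fun f : C(X, Y) => ∀ x, q (f x) = q (f₁ x)) =
            fun f : C(X, Y) => ∀ x, q (f x) = q (f₀ x) := by
          funext f
          simp only [h.map_eq]
        unfold HomotopicOver
        rw [e]
        exact ContinuousMap.HomotopicWith.symm h
      trans := fun {f₀ f₁ f₂} h k => by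
        have e : (fun f : C(X, Y) => ∀ x, q (f x) = q (f₁ x)) =
            fun f : C(X, Y) => ∀ x, q (f x) = q (f₀ x) := by
          funext f
          simp only [h.map_eq]
        unfold HomotopicOver at k
        rw [e] at k
        exact ContinuousMap.HomotopicWith.trans h k }

/-- The set `[X, Y]_S` of homotopy classes over `S` of maps `X → Y`, where `Y` is a space over `S`
by `q`. Every map `f : X → Y` is a map over `S` once `X` is given the projection `q ∘ f`, so this is
the disjoint union, over all maps `X → S`, of the sets of homotopy classes of maps over `S` from the
space `X` over `S` so obtained to `Y`. -/
def HomotopyClassesOver (X : Type*) {Y S : Type*} [TopologicalSpace X] [TopologicalSpace Y]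
    (q : Y → S) : Type _ :=
  Quotient (homotopicOverSetoid X q)

/-- A map `f : X → Y` of spaces over `S` is a homotopy equivalence over `S`. -/
def IsHomotopyEquivOver {X Y S : Type*} [TopologicalSpace X] [TopologicalSpace Y]
    (p : X → S) (q : Y → S) (f : C(X, Y)) : Prop :=
  (∀ x, q (f x) = p x) ∧ ∃ g : C(Y, X), (∀ y, p (g y) = q y) ∧
    HomotopicOver p (g.comp f) (ContinuousMap.id X) ∧
    HomotopicOver q (f.comp g) (ContinuousMap.id Y)

/-- A space `X` over `S` is contractible as a space over `S` if its projection to `S` is a homotopy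
equivalence over `S` (where `S` is a space over itself by the identity). -/
def IsContractibleOver {X S : Type*} [TopologicalSpace X] [TopologicalSpace S] (p : C(X, S)) :
    Prop :=
  IsHomotopyEquivOver p id p

/-- `π : P → M` is a right principal `G` bundle: a continuous fibre-preserving right action of `G`
(that is, an action of `Gᵐᵒᵖ`) on `P`, such that `P` has, near every point of `M`, a
`G`-equivariant local trivialization by `U × G`, where `G` acts by right multiplication. -/
structure IsPrincipalBundle (G : Type*) {P M : Type*} [Group G] [TopologicalSpace G]
    [TopologicalSpace P] [TopologicalSpace M] [MulAction Gᵐᵒᵖ P] (π : P → M) : Prop where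
  continuous_act : Continuous fun x : P × G => MulOpposite.op x.2 • x.1
  proj_act : ∀ (p : P) (g : G), π (MulOpposite.op g • p) = π p
  locally_trivial : ∀ m : M, ∃ e : Bundle.Trivialization G π, m ∈ e.baseSet ∧
    ∀ p : P, π p ∈ e.baseSet → ∀ g : G, e (MulOpposite.op g • p) = (π p, (e p).2 * g)

section

variable {H : Type uH} {G : Type uG} [Group H] [TopologicalSpace H] [IsTopologicalGroup H]
  [Group G] [TopologicalSpace G] [IsTopologicalGroup G]

/-- An `(H, G)` bibundle on `M`: a right principal `G` bundle `proj : Total → M` with a structure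
map `str : Total → H` satisfying `str (p g) = str p * t g`. -/
structure Bibundle (C : TopCrossedModule H G) (M : Type v) [TopologicalSpace M] where
  Total : Type w
  [top : TopologicalSpace Total]
  [act : MulAction Gᵐᵒᵖ Total]
  proj : C(Total, M)
  principal : IsPrincipalBundle G proj
  str : C(Total, H)
  str_act : ∀ (p : Total) (g : G), str (MulOpposite.op g • p) = str p * C.t g

namespace Bibundle

attribute [instance] Bibundle.top Bibundle.act

variable {C : TopCrossedModule H G} {M : Type v} [TopologicalSpace M]

theorem proj_surjective (P : Bibundle.{uH, uG, v, w} C M) : Function.Surjective P.proj := by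
  intro m
  obtain ⟨e, hm, -⟩ := P.principal.locally_trivial m
  exact ⟨e.toOpenPartialHomeomorph.symm (m, 1), e.proj_symm_apply' hm⟩

/-- Two points of the same fibre differ by an element of `G`. -/
theorem exists_act_eq (P : Bibundle.{uH, uG, v, w} C M) {p q : P.Total}
    (h : P.proj p = P.proj q) : ∃ g : G, MulOpposite.op g • p = q := by
  obtain ⟨e, hm, he⟩ := P.principal.locally_trivial (P.proj p)
  refine ⟨(e p).2⁻¹ * (e q).2, ?_⟩
  have hq : P.proj q ∈ e.baseSet := h ▸ hm
  apply e.injOn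
  · rw [e.source_eq, Set.mem_preimage, P.principal.proj_act]
    exact hm
  · rw [e.source_eq]
    exact hq
  · have h1 := he p hm ((e p).2⁻¹ * (e q).2)
    rw [mul_inv_cancel_left, h] at h1
    exact h1.trans (e.mk_proj_snd' hq)

/-- The type map `M → H / t(G)` of a bibundle as a function: it sends `m` to the coset of
`str p`, for any `p` in the fibre over `m`. -/
noncomputable def typeFun (P : Bibundle.{uH, uG, v, w} C M) (m : M) : H ⧸ C.t.range :=
  QuotientGroup.mk (P.str (P.proj_surjective m).choose)

theorem typeFun_proj (P : Bibundle.{uH, uG, v, w} C M) (p : P.Total) :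
    P.typeFun (P.proj p) = QuotientGroup.mk (P.str p) := by
  obtain ⟨g, hg⟩ := P.exists_act_eq (P.proj_surjective (P.proj p)).choose_spec
  unfold typeFun
  rw [QuotientGroup.eq]
  refine ⟨g, ?_⟩
  rw [eq_inv_mul_iff_mul_eq, ← P.str_act, hg]

theorem continuous_typeFun (P : Bibundle.{uH, uG, v, w} C M) : Continuous P.typeFun := by
  rw [continuous_iff_continuousAt]
  intro m
  obtain ⟨e, hm, -⟩ := P.principal.locally_trivial m
  have hs : ContinuousOn (fun x => e.toOpenPartialHomeomorph.symm (x, (1 : G))) e.baseSet :=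
    e.continuousOn_symm_prodMk_left
  have h1 : ContinuousOn (fun x => (QuotientGroup.mk
      (P.str (e.toOpenPartialHomeomorph.symm (x, (1 : G)))) : H ⧸ C.t.range)) e.baseSet :=
    (QuotientGroup.continuous_mk.comp P.str.continuous).comp_continuousOn hs
  refine (h1.congr fun x hx => ?_).continuousAt (e.open_baseSet.mem_nhds hm)
  rw [← P.typeFun_proj, e.proj_symm_apply' hx]

/-- The type map `M → H / t(G)` of a bibundle on `M`. -/
noncomputable def typeMap (P : Bibundle.{uH, uG, v, w} C M) : C(M, H ⧸ C.t.range) :=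
  ⟨P.typeFun, P.continuous_typeFun⟩

/-- An isomorphism of bibundles on `M`: a homeomorphism of the total spaces over the identity of `M`
that commutes with the right actions and with the structure maps. -/
structure Iso (P Q : Bibundle.{uH, uG, v, w} C M) where
  toHomeo : P.Total ≃ₜ Q.Total
  proj_eq : ∀ p, Q.proj (toHomeo p) = P.proj p
  map_act : ∀ (p : P.Total) (g : G),
    toHomeo (MulOpposite.op g • p) = MulOpposite.op g • toHomeo p
  str_eq : ∀ p, Q.str (toHomeo p) = P.str p

variable (C M) in
/-- Being isomorphic is an equivalence relation on bibundles on `M`. -/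
def isoSetoid : Setoid (Bibundle.{uH, uG, v, w} C M) where
  r P Q := Nonempty (Iso P Q)
  iseqv :=
    { refl := fun P => ⟨⟨Homeomorph.refl _, fun _ => rfl, fun _ _ => rfl, fun _ => rfl⟩⟩
      symm := fun {P Q} ⟨i⟩ => ⟨⟨i.toHomeo.symm,
        fun q => by rw [← i.proj_eq, Homeomorph.apply_symm_apply],
        fun q g => by
          rw [Homeomorph.symm_apply_eq, i.map_act, Homeomorph.apply_symm_apply],
        fun q => by rw [← i.str_eq, Homeomorph.apply_symm_apply]⟩⟩
      trans := fun {P Q R} ⟨i⟩ ⟨j⟩ => ⟨⟨i.toHomeo.trans j.toHomeo,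
        fun p => by rw [Homeomorph.trans_apply, j.proj_eq, i.proj_eq],
        fun p g => by simp only [Homeomorph.trans_apply, i.map_act, j.map_act],
        fun p => by rw [Homeomorph.trans_apply, j.str_eq, i.str_eq]⟩⟩ }

variable (C M) in
/-- The set of isomorphism classes of bibundles on `M`. -/
def IsoClasses : Type _ := Quotient (isoSetoid.{uH, uG, v, w} C M)

section Pullback

variable {N : Type u} [TopologicalSpace N] (f : C(N, M)) (P : Bibundle.{uH, uG, v, w} C M)

/-- The total space `N ×_M P` of the pullback, with the subspace topology from `N × P`. -/
abbrev PullbackTotal : Type (max u w) := {x : N × P.Total // f x.1 = P.proj x.2}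

instance : MulAction Gᵐᵒᵖ (PullbackTotal f P) where
  smul g x := ⟨(x.1.1, g • x.1.2), by
    rw [← MulOpposite.op_unop g, P.principal.proj_act]; exact x.2⟩
  one_smul x := Subtype.ext (Prod.ext rfl (one_smul _ x.1.2))
  mul_smul g h x := Subtype.ext (Prod.ext rfl (mul_smul g h x.1.2))

/-- The projection of the pullback to `N`. -/
def pullbackProj : C(PullbackTotal f P, N) :=
  ⟨fun x => x.1.1, continuous_fst.comp continuous_subtype_val⟩

/-- The canonical map from the pullback to the total space of the original bibundle. -/
def pullbackLift : C(PullbackTotal f P, P.Total) :=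
  ⟨fun x => x.1.2, continuous_snd.comp continuous_subtype_val⟩

open Classical in
/-- The inverse of the local trivialization of the pullback that is induced by a local trivialization
of `P` over `U` (with an irrelevant value outside `f ⁻¹ U`). -/
noncomputable def pullbackSymm (e : Bundle.Trivialization G P.proj) (y : N × G) :
    PullbackTotal f P :=
  if h : f y.1 ∈ e.baseSet then
    ⟨(y.1, e.toOpenPartialHomeomorph.symm (f y.1, y.2)), (e.proj_symm_apply' h).symm⟩
  else ⟨(y.1, (P.proj_surjective (f y.1)).choose), (P.proj_surjective (f y.1)).choose_spec.symm⟩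

theorem pullbackSymm_val (e : Bundle.Trivialization G P.proj) {y : N × G}
    (h : f y.1 ∈ e.baseSet) : (pullbackSymm f P e y).1 =
      (y.1, e.toOpenPartialHomeomorph.symm (f y.1, y.2)) := by
  unfold pullbackSymm
  rw [dif_pos h]

/-- A local trivialization of `P` over `U` gives one of the pullback over `f ⁻¹ U`. -/
noncomputable def pullbackTriv (e : Bundle.Trivialization G P.proj) :
    Bundle.Trivialization G (pullbackProj f P) where
  toFun x := (x.1.1, (e x.1.2).2)
  invFun := pullbackSymm f P e
  source := pullbackProj f P ⁻¹' (f ⁻¹' e.baseSet)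
  target := (f ⁻¹' e.baseSet) ×ˢ Set.univ
  map_source' x hx := ⟨hx, trivial⟩
  map_target' y hy := by
    change f (pullbackSymm f P e y).1.1 ∈ e.baseSet
    rw [pullbackSymm_val f P e hy.1]
    exact hy.1
  left_inv' x hx := by
    have h : f x.1.1 ∈ e.baseSet := hx
    apply Subtype.ext
    rw [pullbackSymm_val f P e (y := (x.1.1, (e x.1.2).2)) h]
    refine Prod.ext rfl ?_
    change e.toOpenPartialHomeomorph.symm (f x.1.1, (e x.1.2).2) = x.1.2
    rw [x.2]
    exact e.symm_apply_mk_proj (e.mem_source.2 (x.2 ▸ h))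
  right_inv' y hy := by
    have h : f y.1 ∈ e.baseSet := hy.1
    rw [pullbackSymm_val f P e h]
    refine Prod.ext rfl ?_
    change (e (e.toOpenPartialHomeomorph.symm (f y.1, y.2))).2 = y.2
    rw [e.apply_symm_apply' h]
  open_source := (e.open_baseSet.preimage f.continuous).preimage (pullbackProj f P).continuous
  open_target := (e.open_baseSet.preimage f.continuous).prod isOpen_univ
  continuousOn_toFun := by
    refine ContinuousOn.prodMk (pullbackProj f P).continuous.continuousOn ?_
    refine continuous_snd.comp_continuousOn
      (ContinuousOn.comp (g := e) (f := pullbackLift f P) e.continuousOn_toFun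
        (pullbackLift f P).continuous.continuousOn ?_)
    intro x hx
    have h : f x.1.1 ∈ e.baseSet := hx
    exact e.mem_source.2 (x.2 ▸ h)
  continuousOn_invFun := by
    refine (Topology.IsInducing.subtypeVal
      (t := {x : N × P.Total | f x.1 = P.proj x.2})).continuousOn_iff.2 ?_
    have h1 : ContinuousOn (fun y : N × G => (f y.1, y.2)) ((f ⁻¹' e.baseSet) ×ˢ Set.univ) :=
      (f.continuous.prodMap continuous_id).continuousOn
    refine (continuous_fst.continuousOn.prodMk (e.continuousOn_invFun.comp h1 ?_)).congr ?_
    · intro y hy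
      exact e.mem_target.2 hy.1
    · intro y hy
      exact pullbackSymm_val f P e hy.1
  baseSet := f ⁻¹' e.baseSet
  open_baseSet := e.open_baseSet.preimage f.continuous
  source_eq := rfl
  target_eq := rfl
  proj_toFun _ _ := rfl

/-- The pullback `f^* P = N ×_M P` of a bibundle `P` on `M` along `f : N → M`, with the action and
the structure map of `P` on the second component. -/
def pullback : Bibundle.{uH, uG, u, max u w} C N where
  Total := PullbackTotal f P
  proj := pullbackProj f P
  principal :=
    { continuous_act := by
        refine Continuous.subtype_mk (f := fun x : PullbackTotal f P × G =>
          (x.1.1.1, MulOpposite.op x.2 • x.1.1.2)) ?_ _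
        exact ((pullbackProj f P).continuous.comp continuous_fst).prodMk
          (P.principal.continuous_act.comp
            (((pullbackLift f P).continuous.comp continuous_fst).prodMk continuous_snd))
      proj_act := fun _ _ => rfl
      locally_trivial := fun n => by
        obtain ⟨e, hm, he⟩ := P.principal.locally_trivial (f n)
        refine ⟨pullbackTriv f P e, hm, fun x hx g => ?_⟩
        have h : f x.1.1 ∈ e.baseSet := hx
        have h2 := congrArg Prod.snd (he x.1.2 (x.2 ▸ h) g)
        exact Prod.ext rfl h2 }
  str := P.str.comp (pullbackLift f P)
  str_act x g := P.str_act x.1.2 g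

end Pullback

end Bibundle

end

section

open Topology Set unitInterval

/-! The theorem rests on two deformations, each assembled from local moves by bump functions on `M`.

Well-definedness is homotopy invariance. A homotopy over `H / t(G)` pulls `E` back to a bibundle on
`M × I` whose type does not depend on time. The structure map of a local section then changes in
time by elements of `t(G)`. These lift locally and continuously to `G`, so the section can be
corrected to a flat one, with structure map constant in time (`exists_isFlatSectionOn_prod`).
Compactness of `I` makes flat sections available over sets `V × I`, and moving points along them
gives a transport that preserves the structure map (`exists_transport`). Transport from time 0 to
time 1 compares the two pullbacks.

Bijectivity concerns equivariant maps `P → E` over `H`: such a map covers some `f : M → B` and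
identifies `P` with `f^* E`. It amounts to an equivariant section of `P ×_H E → P`, which is
fibrewise contractible because `E` is contractible over `H`. The contraction is not equivariant, but
over a chart of `P` it can be made so by spreading it from one slice along the action. Composing the
cut-off local contractions gives an equivariant deformation whose end stage forgets the point of `E`
(`exists_equivariant_contraction`). Existence of an equivariant map gives surjectivity, and its
uniqueness up to equivariant homotopy over `H` gives injectivity. -/

/-! ### Locally finite composition of local moves -/

/-- The invariant `Q` persists through the fold, so every omitted step is an identity where it would
be applied. In the application `Q` fixes the point of the base. -/
theorem List.foldl_eq_foldl_filter {α β : Type*} (f : α → β → α) (p : β → Prop) [DecidablePred p]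
    (Q : α → Prop) (l : List β) (hQ : ∀ a b, Q a → Q (f a b)) (hf : ∀ a b, Q a → ¬p b → f a b = a)
    (a : α) (ha : Q a) : l.foldl f a = (l.filter p).foldl f a := by
  induction l generalizing a with
  | nil => rfl
  | cons b l ih =>
    by_cases hb : p b
    · rw [List.filter_cons_of_pos (by simpa using hb), List.foldl_cons, List.foldl_cons]
      exact ih _ (hQ a b ha)
    · rw [List.filter_cons_of_neg (by simpa using hb), List.foldl_cons, hf a b ha hb]
      exact ih a ha

/-- A locally finite family of continuous self-maps of a space over `M` can be composed, in some
order, to a continuous self-map. -/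
theorem exists_list_continuous_foldl {X M J : Type*} [TopologicalSpace X] [TopologicalSpace M]
    {q : X → M} (hq : Continuous q) {S : J → Set M} (hS : LocallyFinite S) (a : X → J → X)
    (ha : ∀ j, Continuous fun x => a x j) (hqa : ∀ x j, q (a x j) = q x)
    (hid : ∀ x j, q x ∉ S j → a x j = x) :
    ∃ l : M → List J, (∀ m j, j ∈ l m ↔ m ∈ S j) ∧
      Continuous fun x => (l (q x)).foldl a x := by
  classical
  -- With one order on all of `J`, the list at a point of a small open set is a filtered part of a
  -- single finite list, that of the indices whose sets meet the neighbourhood.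
  let : LinearOrder J := IsWellOrder.linearOrder WellOrderingRel
  refine ⟨fun m => (hS.point_finite m).toFinset.sort, fun m j => by simp, ?_⟩
  rw [continuous_iff_continuousAt]
  intro x₀
  obtain ⟨N, hN, hfin⟩ := hS (q x₀)
  have hcont : ∀ l : List J, Continuous fun x => l.foldl a x := by
    intro l
    induction l with
    | nil => exact continuous_id
    | cons j l ih => exact ih.comp (ha j)
  refine (hcont hfin.toFinset.sort).continuousAt.congr ?_
  filter_upwards [hq.continuousAt hN] with x hx
  rw [List.foldl_eq_foldl_filter a (fun j => q x ∈ S j) (fun y => q y = q x) _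
    (fun y j hy => (hqa y j).trans hy) (fun y j hy hj => hid y j (hy ▸ hj)) x rfl]
  congr 1
  have hnd : (List.filter (fun j => decide (q x ∈ S j)) hfin.toFinset.sort).Nodup :=
    (Finset.sort_nodup _ _).filter _
  rw [← (List.toFinset_sort (· ≤ ·) hnd).2 ((Finset.pairwise_sort _ _).filter _)]
  congr 1
  ext j
  simp only [List.mem_toFinset, List.mem_filter, Finset.mem_sort, Set.Finite.mem_toFinset,
    mem_ofPred_eq, decide_eq_true_eq, and_iff_right_iff_imp]
  exact fun hj => ⟨q x, hj, hx⟩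

-- This extends a move defined over a chart by the identity: on the open set `U` the function is
-- `f`, and on the complement of `Z` it is `g`, so values of `f` outside `U` play no role.
open Classical in
theorem continuous_ite_mem {X Y : Type*} [TopologicalSpace X] [TopologicalSpace Y] {U Z : Set X}
    (hU : IsOpen U) (hZ : IsClosed Z) (hZU : Z ⊆ U) {f g : X → Y} (hf : ContinuousOn f U)
    (hg : Continuous g) (hfg : ∀ x ∈ U, x ∉ interior Z → f x = g x) :
    Continuous fun x => if x ∈ Z then f x else g x := by
  rw [continuous_iff_continuousAt]
  intro x
  by_cases hx : x ∈ Z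
  · refine (hf.continuousAt (hU.mem_nhds (hZU hx))).congr ?_
    filter_upwards [hU.mem_nhds (hZU hx)] with y hy
    split_ifs with h
    · rfl
    · exact hfg y hy fun h' => h (interior_subset h')
  · refine hg.continuousAt.congr ?_
    filter_upwards [hZ.isOpen_compl.mem_nhds hx] with y hy
    rw [if_neg hy]

variable {H : Type uH} {G : Type uG} [Group H] [TopologicalSpace H] [IsTopologicalGroup H]
  [Group G] [TopologicalSpace G] [IsTopologicalGroup G]

/-! ### Differences in a fibre and maps of bibundles -/

namespace Bibundle

variable {C : TopCrossedModule H G} {M : Type v} [TopologicalSpace M]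

theorem isOpenQuotientMap_proj (P : Bibundle.{uH, uG, v, w} C M) : IsOpenQuotientMap P.proj := by
  refine ⟨P.proj_surjective, P.proj.continuous, isOpenMap_iff_nhds_le.2 fun p => ?_⟩
  obtain ⟨e, hm, -⟩ := P.principal.locally_trivial (P.proj p)
  exact (e.map_proj_nhds (e.mem_source.2 hm)).ge

theorem act_injective (P : Bibundle.{uH, uG, v, w} C M) {p : P.Total} {g g' : G}
    (h : MulOpposite.op g • p = MulOpposite.op g' • p) : g = g' := by
  obtain ⟨e, hm, he⟩ := P.principal.locally_trivial (P.proj p)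
  have h1 := he p hm g
  rw [h, he p hm g'] at h1
  exact (mul_left_cancel (congrArg Prod.snd h1)).symm

open Classical in
/-- The element of `G` that carries `x.1` to `x.2`, for points `x.1` and `x.2` of the same fibre
(and `1` otherwise). -/
noncomputable def diff (P : Bibundle.{uH, uG, v, w} C M) (x : P.Total × P.Total) : G :=
  if h : P.proj x.1 = P.proj x.2 then (P.exists_act_eq h).choose else 1

theorem act_diff (P : Bibundle.{uH, uG, v, w} C M) {p q : P.Total} (h : P.proj p = P.proj q) :
    MulOpposite.op (P.diff (p, q)) • p = q := by
  unfold diff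
  rw [dif_pos h]
  exact (P.exists_act_eq h).choose_spec

theorem diff_eq (P : Bibundle.{uH, uG, v, w} C M) {p q : P.Total} {g : G}
    (h : MulOpposite.op g • p = q) : P.diff (p, q) = g :=
  P.act_injective ((P.act_diff (by rw [← h, P.principal.proj_act])).trans h.symm)

/-- In an equivariant chart the difference is the quotient of the two fibre coordinates. -/
theorem continuousOn_diff (P : Bibundle.{uH, uG, v, w} C M) :
    ContinuousOn P.diff {x | P.proj x.1 = P.proj x.2} := by
  intro x hx
  obtain ⟨e, hm, he⟩ := P.principal.locally_trivial (P.proj x.1)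
  have hx' : P.proj x.1 = P.proj x.2 := hx
  have hm2 : P.proj x.2 ∈ e.baseSet := hx' ▸ hm
  have h1 : ContinuousAt (fun y : P.Total × P.Total => (e y.1).2⁻¹ * (e y.2).2) x :=
    (continuousAt_snd.comp ((e.continuousAt (e.mem_source.2 hm)).comp continuousAt_fst)).inv.mul
      (continuousAt_snd.comp ((e.continuousAt (e.mem_source.2 hm2)).comp continuousAt_snd))
  have hU : ∀ᶠ y : P.Total × P.Total in 𝓝 x, P.proj y.1 ∈ e.baseSet :=
    (P.proj.continuous.comp continuous_fst).continuousAt (e.open_baseSet.mem_nhds hm)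
  refine h1.continuousWithinAt.congr_of_eventuallyEq_of_mem ?_ hx
  filter_upwards [nhdsWithin_le_nhds hU, self_mem_nhdsWithin] with y hy hy2
  have hy3 : P.proj y.1 = P.proj y.2 := hy2
  have h2 := congrArg Prod.snd (he y.1 hy (P.diff (y.1, y.2)))
  rw [P.act_diff hy3] at h2
  change (e y.2).2 = (e y.1).2 * P.diff y at h2
  rw [h2, inv_mul_cancel_left]

/-- A map of bibundles over the identity of `M` is an isomorphism. -/
theorem nonempty_iso {P Q : Bibundle.{uH, uG, v, w} C M} (F : C(P.Total, Q.Total))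
    (hproj : ∀ p, Q.proj (F p) = P.proj p)
    (hact : ∀ (p : P.Total) (g : G), F (MulOpposite.op g • p) = MulOpposite.op g • F p)
    (hstr : ∀ p, Q.str (F p) = P.str p) : Nonempty (Iso P Q) := by
  have hbij : Function.Bijective F := by
    constructor
    · intro p p' h
      have h1 : P.proj p = P.proj p' := by rw [← hproj, h, hproj]
      have h2 := hact p (P.diff (p, p'))
      rw [P.act_diff h1, ← h] at h2
      have h3 : P.diff (p, p') = 1 := Q.act_injective (p := F p) (by rw [← h2]; simp)
      have h4 := P.act_diff h1
      rwa [h3, MulOpposite.op_one, one_smul] at h4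
    · intro q
      obtain ⟨p, hp⟩ := P.proj_surjective (Q.proj q)
      refine ⟨MulOpposite.op (Q.diff (F p, q)) • p, ?_⟩
      rw [hact, Q.act_diff (by rw [hproj, hp])]
  let f := Equiv.ofBijective F hbij
  have hfF : ∀ p, f p = F p := fun _ => rfl
  have hcont : Continuous f.symm := by
    rw [continuous_iff_continuousAt]
    intro q₀
    obtain ⟨e, hm, he⟩ := P.principal.locally_trivial (Q.proj q₀)
    have hU : IsOpen (Q.proj ⁻¹' e.baseSet) := e.open_baseSet.preimage Q.proj.continuous
    obtain ⟨τ, hτ⟩ : ∃ τ : M → P.Total, τ = fun x => e.toOpenPartialHomeomorph.symm (x, 1) :=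
      ⟨_, rfl⟩
    have hτc : ContinuousOn (fun q => τ (Q.proj q)) (Q.proj ⁻¹' e.baseSet) := by
      rw [hτ]
      exact e.continuousOn_symm_prodMk_left.comp Q.proj.continuous.continuousOn fun _ h => h
    have hpτ : ∀ q, Q.proj q ∈ e.baseSet → Q.proj (F (τ (Q.proj q))) = Q.proj q := by
      intro q h
      rw [hproj, hτ, e.proj_symm_apply' h]
    have hd : ContinuousOn (fun q => Q.diff (F (τ (Q.proj q)), q)) (Q.proj ⁻¹' e.baseSet) :=
      Q.continuousOn_diff.comp ((F.continuous.comp_continuousOn hτc).prodMk continuousOn_id) hpτ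
    -- The preimage of `q` is the local section `τ` of `P` moved by the element that carries `F (τ
    -- x)` to `q`.
    have h1 : ContinuousOn f.symm (Q.proj ⁻¹' e.baseSet) := by
      refine (P.principal.continuous_act.comp_continuousOn (hτc.prodMk hd)).congr fun q h => ?_
      rw [Equiv.symm_apply_eq, hfF]
      change q = F (MulOpposite.op (Q.diff (F (τ (Q.proj q)), q)) • τ (Q.proj q))
      rw [hact, Q.act_diff (hpτ q h)]
    exact h1.continuousAt (hU.mem_nhds hm)
  exact ⟨⟨⟨f, F.continuous, hcont⟩, hproj, hact, hstr⟩⟩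

end Bibundle

/-! ### Equivariant contraction of `P ×_H E` over `P` -/

namespace Bibundle

variable {C : TopCrossedModule H G} {M : Type uM} [TopologicalSpace M]
  {B : Type uB} [TopologicalSpace B]

/-- Pairs of points of two bibundles with the same value in `H`. -/
abbrev StrPairs (P : Bibundle.{uH, uG, uM, w} C M) (E : Bibundle.{uH, uG, uB, uE} C B) :
    Type (max w uE) := {y : P.Total × E.Total // P.str y.1 = E.str y.2}

/-- Bump functions with values in `I` that are subordinate to an open cover. -/
theorem exists_bumpCovering_unitInterval [T2Space M] [ParacompactSpace M] {ι : Type*}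
    (U : ι → Set M) (hU : ∀ i, IsOpen (U i)) (hUM : ∀ x, ∃ i, x ∈ U i) :
    ∃ w : ι → C(M, I), LocallyFinite (fun i => tsupport (w i)) ∧ (∀ i, tsupport (w i) ⊆ U i) ∧
      ∀ x, ∃ i, w i x = 1 := by
  obtain ⟨f, hf⟩ := BumpCovering.exists_isSubordinate isClosed_univ U hU
    (fun x _ => mem_iUnion.2 (hUM x))
  have hs : ∀ i, tsupport (fun x => (⟨f i x, f.nonneg i x, f.le_one i x⟩ : I)) =
      tsupport (f i) := by
    intro i
    unfold tsupport
    congr 1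
    ext x
    simp [Function.mem_support, Subtype.ext_iff]
  refine ⟨fun i => ⟨fun x => ⟨f i x, f.nonneg i x, f.le_one i x⟩, by fun_prop⟩, ?_, ?_, ?_⟩
  · simpa only [ContinuousMap.coe_mk, hs] using f.locallyFinite_tsupport
  · intro i
    exact (hs i).trans_subset (hf i)
  · exact fun x => ⟨f.ind x (mem_univ x), Subtype.ext (f.ind_apply x (mem_univ x))⟩

/-- If `E` is contractible over `H`, then equivariant maps over `H` from a bibundle `P` to `E` exist
and are all equivariantly homotopic over `H`: the space of pairs of points of `P` and `E` over the
same point of `H` deforms equivariantly over `P` to the graph of such a map. -/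
theorem exists_equivariant_contraction [T2Space M] [ParacompactSpace M]
    (P : Bibundle.{uH, uG, uM, w} C M) (E : Bibundle.{uH, uG, uB, uE} C B)
    (hE : IsContractibleOver E.str) :
    ∃ A : I → P.Total → E.Total → E.Total,
      (Continuous fun y : I × StrPairs P E => A y.1 y.2.1.1 y.2.1.2) ∧
      (∀ r p e, P.str p = E.str e → E.str (A r p e) = P.str p) ∧
      (∀ p e, P.str p = E.str e → A 0 p e = e) ∧
      (∀ r p e (g : G), P.str p = E.str e →
        A r (MulOpposite.op g • p) (MulOpposite.op g • e) = MulOpposite.op g • A r p e) ∧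
      (∀ p e e', P.str p = E.str e → P.str p = E.str e' → A 1 p e = A 1 p e') := by
  classical
  obtain ⟨-, s, -, hK, -⟩ := hE
  -- Reversed, the homotopy starts at the identity and ends at `s ∘ ψ`, which depends only on the
  -- value in `H`.
  obtain ⟨K⟩ := (homotopicOverSetoid E.Total E.str).symm hK
  have hKstr : ∀ r e, E.str (K (r, e)) = E.str e := fun r e => K.prop r e
  have hK0 : ∀ e, K (0, e) = e := K.apply_zero
  have hK1 : ∀ e, K (1, e) = s (E.str e) := K.apply_one
  choose triv htriv hact using P.principal.locally_trivial
  obtain ⟨w, hwfin, hwU, hw1⟩ := exists_bumpCovering_unitInterval (fun m => (triv m).baseSet)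
    (fun m => (triv m).open_baseSet) (fun x => ⟨x, htriv x⟩)
  let X := I × StrPairs P E
  let q : X → M := fun y => P.proj y.2.1.1
  have hq : Continuous q := P.proj.continuous.comp
    (continuous_fst.comp (continuous_subtype_val.comp continuous_snd))
  let c : M → X → G := fun j y => (triv j y.2.1.1).2
  -- The pair is moved to the slice of `P` with fibre coordinate 1, contracted there up to time `y.1
  -- * w j`, and moved back. This makes the move equivariant although `K` is not, and the weight
  -- makes it the identity where `w j` vanishes.
  let b : M → X → E.Total := fun j y => MulOpposite.op (c j y) •
    K (y.1 * w j (q y), MulOpposite.op (c j y)⁻¹ • y.2.1.2)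
  have hb : ∀ j y, P.str y.2.1.1 = E.str (b j y) := by
    intro j y
    simp only [b, E.str_act, hKstr, map_inv, inv_mul_cancel_right]
    exact y.2.2
  let a : X → M → X := fun y j =>
    if y ∈ q ⁻¹' tsupport (w j) then (y.1, ⟨(y.2.1.1, b j y), hb j y⟩) else y
  have hout : ∀ j y, w j (q y) = 0 → b j y = y.2.1.2 := by
    intro j y h
    simp only [b, h, mul_zero, hK0]
    rw [smul_smul, ← MulOpposite.op_mul, inv_mul_cancel, MulOpposite.op_one, one_smul]
  have hc : ∀ j, ContinuousOn (c j) (q ⁻¹' (triv j).baseSet) := by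
    intro j
    refine continuous_snd.comp_continuousOn ((triv j).continuousOn_toFun.comp
      (continuous_fst.comp (continuous_subtype_val.comp continuous_snd)).continuousOn ?_)
    exact fun y hy => (triv j).mem_source.2 hy
  have hbc : ∀ j, ContinuousOn (b j) (q ⁻¹' (triv j).baseSet) := by
    intro j
    have h2 : Continuous fun y : X => y.2.1.2 :=
      continuous_snd.comp (continuous_subtype_val.comp continuous_snd)
    refine E.principal.continuous_act.comp_continuousOn (ContinuousOn.prodMk ?_ (hc j))
    refine K.continuous.comp_continuousOn (ContinuousOn.prodMk ?_ ?_)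
    · exact (continuous_fst.mul ((w j).continuous.comp hq)).continuousOn
    · exact E.principal.continuous_act.comp_continuousOn (h2.continuousOn.prodMk (hc j).inv)
  have hacont : ∀ j, Continuous fun y => a y j := by
    intro j
    refine continuous_ite_mem (g := fun y => y) ((triv j).open_baseSet.preimage hq)
      ((isClosed_tsupport (w j)).preimage hq) (preimage_mono (hwU j)) ?_ continuous_id ?_
    · refine continuousOn_fst.prodMk (Topology.IsInducing.subtypeVal.continuousOn_iff.2 ?_)
      exact (continuous_fst.comp (continuous_subtype_val.comp continuous_snd)).continuousOn.prodMk
        (hbc j)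
    · intro y _ hy
      have h0 : w j (q y) = 0 := by
        by_contra h
        refine hy (mem_interior.2 ⟨q ⁻¹' Function.support (w j),
          preimage_mono (subset_tsupport _), ?_, h⟩)
        exact (isOpen_ne.preimage (w j).continuous).preimage hq
      exact Prod.ext rfl (Subtype.ext (Prod.ext rfl (hout j y h0)))
  have ha1 : ∀ y j, (a y j).1 = y.1 := by
    intro y j; simp only [a]; split_ifs <;> rfl
  have ha2 : ∀ y j, (a y j).2.1.1 = y.2.1.1 := by
    intro y j; simp only [a]; split_ifs <;> rfl
  have ha3 : ∀ y j, q y ∈ tsupport (w j) → (a y j).2.1.2 = b j y := by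
    intro y j h; simp only [a]; rw [if_pos (by exact h)]
  have ha4 : ∀ y j, q y ∉ tsupport (w j) → a y j = y := by
    intro y j h; simp only [a]; rw [if_neg (by exact h)]
  have hqa : ∀ y j, q (a y j) = q y := fun y j => congrArg P.proj (ha2 y j)
  obtain ⟨l, hl, hlc⟩ := exists_list_continuous_foldl hq hwfin a hacont hqa ha4
  let T : X → X := fun y => (l (q y)).foldl a y
  have hT1 : ∀ (k : List M) y, (k.foldl a y).1 = y.1 ∧ (k.foldl a y).2.1.1 = y.2.1.1 := by
    intro k
    induction k with
    | nil => exact fun y => ⟨rfl, rfl⟩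
    | cons j k ih =>
      exact fun y => ⟨(ih _).1.trans (ha1 y j), (ih _).2.trans (ha2 y j)⟩
  have hT0 : ∀ (k : List M) y, y.1 = 0 → (k.foldl a y).2.1.2 = y.2.1.2 := by
    intro k
    induction k with
    | nil => exact fun y _ => rfl
    | cons j k ih =>
      intro y hy
      refine (ih _ ((ha1 y j).trans hy)).trans ?_
      by_cases h : q y ∈ tsupport (w j)
      · rw [ha3 y j h]
        simp only [b, hy, zero_mul, hK0]
        rw [smul_smul, ← MulOpposite.op_mul, inv_mul_cancel, MulOpposite.op_one, one_smul]
      · rw [ha4 y j h]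
  have hTg : ∀ (g : G) (k : List M) (y y' : X), y'.1 = y.1 →
      y'.2.1.1 = MulOpposite.op g • y.2.1.1 → y'.2.1.2 = MulOpposite.op g • y.2.1.2 →
      (k.foldl a y').2.1.2 = MulOpposite.op g • (k.foldl a y).2.1.2 := by
    intro g k
    induction k with
    | nil => exact fun y y' _ _ h => h
    | cons j k ih =>
      intro y y' h1 h2 h3
      have hqy : q y' = q y := by
        change P.proj y'.2.1.1 = P.proj y.2.1.1
        rw [h2, P.principal.proj_act]
      by_cases h : q y ∈ tsupport (w j)
      · have h' : q y' ∈ tsupport (w j) := hqy ▸ h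
        refine ih _ _ (by rw [ha1, ha1, h1]) (by rw [ha2, ha2, h2]) ?_
        rw [ha3 y j h, ha3 y' j h']
        have hcg : c j y' = c j y * g := by
          simp only [c]
          rw [h2, hact j _ (hwU j h) g]
        simp only [b, hcg, h1, h3, hqy, mul_inv_rev, smul_smul, ← MulOpposite.op_mul,
          mul_inv_cancel_left]
      · have h' : q y' ∉ tsupport (w j) := hqy ▸ h
        rw [List.foldl_cons, List.foldl_cons, ha4 y j h, ha4 y' j h']
        exact ih _ _ h1 h2 h3
  -- At time 1 a step of weight 1 applies `K (1, ·)` and so erases the difference between two points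
  -- of `E` over the same point of `P`. Later steps keep equal points equal.
  have hTe : ∀ (k : List M) (y y' : X), y.1 = 1 → y'.1 = 1 → y'.2.1.1 = y.2.1.1 →
      (y'.2.1.2 = y.2.1.2 ∨ ∃ j ∈ k, w j (q y) = 1) →
      (k.foldl a y').2.1.2 = (k.foldl a y).2.1.2 := by
    intro k
    induction k with
    | nil =>
      rintro y y' - - - (h | ⟨j, hj, -⟩)
      · exact h
      · simp at hj
    | cons j k ih =>
      intro y y' h1 h1' h2 h3
      have hqy : q y' = q y := congrArg P.proj h2
      refine ih _ _ (by rw [ha1, h1]) (by rw [ha1, h1']) (by rw [ha2, ha2, h2]) ?_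
      rw [hqa]
      have hcy : c j y' = c j y := by simp only [c, h2]
      have hstr : E.str y'.2.1.2 = E.str y.2.1.2 := by rw [← y'.2.2, ← y.2.2, h2]
      by_cases h : q y ∈ tsupport (w j)
      · have h' : q y' ∈ tsupport (w j) := hqy ▸ h
        rw [ha3 y j h, ha3 y' j h']
        rcases h3 with h3 | ⟨i, hi, hi1⟩
        · left
          simp only [b, hcy, h1, h1', hqy, h3]
        · rcases List.mem_cons.1 hi with rfl | hi
          · left
            simp only [b, hcy, h1, h1', hqy, hi1, mul_one, hK1, E.str_act, hstr]
          · exact Or.inr ⟨i, hi, hi1⟩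
      · have h' : q y' ∉ tsupport (w j) := hqy ▸ h
        rw [ha4 y j h, ha4 y' j h']
        rcases h3 with h3 | ⟨i, hi, hi1⟩
        · exact Or.inl h3
        · rcases List.mem_cons.1 hi with rfl | hi
          · refine absurd (subset_tsupport _ ?_) h
            rw [Function.mem_support, hi1]
            exact one_ne_zero
          · exact Or.inr ⟨i, hi, hi1⟩
  let A : I → P.Total → E.Total → E.Total := fun r p e =>
    if h : P.str p = E.str e then (T (r, ⟨(p, e), h⟩)).2.1.2 else e
  have hA : ∀ r p e (h : P.str p = E.str e), A r p e = (T (r, ⟨(p, e), h⟩)).2.1.2 :=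
    fun r p e h => dif_pos h
  refine ⟨A, ?_, ?_, ?_, ?_, ?_⟩
  · have h : Continuous fun y : X => (T y).2.1.2 :=
      continuous_snd.comp (continuous_subtype_val.comp (continuous_snd.comp hlc))
    refine h.congr fun y => ?_
    rw [hA _ _ _ y.2.2]
  · intro r p e h
    rw [hA _ _ _ h, ← (T (r, ⟨(p, e), h⟩)).2.2, (hT1 _ _).2]
  · intro p e h
    rw [hA _ _ _ h]
    exact hT0 _ _ rfl
  · intro r p e g h
    have h' : P.str (MulOpposite.op g • p) = E.str (MulOpposite.op g • e) := by
      rw [P.str_act, E.str_act, h]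
    rw [hA _ _ _ h, hA _ _ _ h']
    have hqq : q (r, ⟨(MulOpposite.op g • p, MulOpposite.op g • e), h'⟩) = q (r, ⟨(p, e), h⟩) :=
      P.principal.proj_act p g
    simp only [T]
    rw [hqq]
    exact hTg g _ _ _ rfl rfl rfl
  · intro p e e' h h'
    rw [hA _ _ _ h, hA _ _ _ h']
    obtain ⟨j, hj⟩ := hw1 (P.proj p)
    refine hTe _ _ _ rfl rfl rfl (Or.inr ⟨j, (hl _ j).2 (subset_tsupport _ ?_), hj⟩)
    change w j (P.proj p) ≠ 0
    rw [hj]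
    exact one_ne_zero

end Bibundle

/-! ### Flat sections and parallel transport -/

/-- The inverse of the homeomorphism `G / ker t ≃ t(G)` is followed by a local section of `G → G /
ker t` near 1. -/
theorem TopCrossedModule.exists_local_lift (C : TopCrossedModule H G)
    (hG : HasLocalSections (QuotientGroup.mk : G → G ⧸ C.t.ker))
    (ht : IsHomeomorph (QuotientGroup.quotientKerEquivRange C.t)) :
    ∃ V : Set C.t.range, IsOpen V ∧ 1 ∈ V ∧ ∃ k : C.t.range → G, ContinuousOn k V ∧
      ∀ v ∈ V, C.t (k v) = v := by
  classical
  obtain ⟨U, hU, h1, s, hs⟩ := hG 1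
  let φ : G ⧸ C.t.ker ≃ₜ C.t.range := ht.homeomorph
  have hφ : ∀ x, φ x = QuotientGroup.quotientKerEquivRange C.t x := fun _ => rfl
  have hφ1 : φ.symm 1 = 1 := by rw [Homeomorph.symm_apply_eq, hφ, map_one]
  refine ⟨φ.symm ⁻¹' U, hU.preimage φ.symm.continuous, by rw [mem_preimage, hφ1]; exact h1,
    fun v => if h : φ.symm v ∈ U then s ⟨φ.symm v, h⟩ else 1, ?_, ?_⟩
  · rw [continuousOn_iff_continuous_domRestrict]
    have h2 : Continuous fun v : φ.symm ⁻¹' U => s ⟨φ.symm v, v.2⟩ :=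
      s.continuous.comp ((φ.symm.continuous.comp continuous_subtype_val).subtype_mk _)
    refine h2.congr fun v => ?_
    rw [Set.domRestrict_apply, dif_pos]
  · intro v hv
    have hv' : φ.symm v ∈ U := hv
    change C.t (if h : φ.symm v ∈ U then s ⟨φ.symm v, h⟩ else 1) = v
    rw [dif_pos hv']
    have h3 : φ (QuotientGroup.mk (s ⟨φ.symm v, hv'⟩)) = v := by
      rw [hs, Homeomorph.apply_symm_apply]
    exact congrArg Subtype.val h3

namespace Bibundle

variable {C : TopCrossedModule H G} {M : Type v} [TopologicalSpace M]

/-- On `W`, the map `τ` is a continuous section of `Q` whose value in `H` does not depend on the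
second coordinate of the base. -/
structure IsFlatSectionOn {N : Type*} [TopologicalSpace N] (Q : Bibundle.{uH, uG, _, w} C (M × N))
    (τ : M × N → Q.Total) (W : Set (M × N)) : Prop where
  continuousOn : ContinuousOn τ W
  proj_eq : ∀ y ∈ W, Q.proj (τ y) = y
  str_eq : ∀ y ∈ W, ∀ y' ∈ W, y.1 = y'.1 → Q.str (τ y) = Q.str (τ y')

theorem IsFlatSectionOn.mono {N : Type*} [TopologicalSpace N]
    {Q : Bibundle.{uH, uG, _, w} C (M × N)} {τ : M × N → Q.Total} {W W' : Set (M × N)}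
    (h : Q.IsFlatSectionOn τ W) (hW : W' ⊆ W) : Q.IsFlatSectionOn τ W' :=
  ⟨h.continuousOn.mono hW, fun y hy => h.proj_eq y (hW hy),
    fun y hy y' hy' => h.str_eq y (hW hy) y' (hW hy')⟩

/-- Any local section `τ` becomes flat after division by a lift to `G` of the change of its
structure map since time `r₀`. That change is 1 at the centre, hence stays near 1, where the lift
exists. -/
theorem exists_isFlatSectionOn_prod
    (hG : HasLocalSections (QuotientGroup.mk : G → G ⧸ C.t.ker))
    (ht : IsHomeomorph (QuotientGroup.quotientKerEquivRange C.t))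
    {N : Type*} [TopologicalSpace N] (Q : Bibundle.{uH, uG, _, w} C (M × N))
    (hQ : ∀ x r r', Q.typeFun (x, r) = Q.typeFun (x, r')) (x₀ : M) (r₀ : N) :
    ∃ V : Set M, ∃ J : Set N, IsOpen V ∧ IsOpen J ∧ x₀ ∈ V ∧ r₀ ∈ J ∧
      ∃ τ, Q.IsFlatSectionOn τ (V ×ˢ J) := by
  classical
  obtain ⟨e, hm, -⟩ := Q.principal.locally_trivial (x₀, r₀)
  obtain ⟨τ, hτ⟩ : ∃ τ : M × N → Q.Total, τ = fun y => e.toOpenPartialHomeomorph.symm (y, 1) :=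
    ⟨_, rfl⟩
  have hτc : ContinuousOn τ e.baseSet := by
    rw [hτ]
    exact e.continuousOn_symm_prodMk_left
  have hpτ : ∀ y ∈ e.baseSet, Q.proj (τ y) = y := by
    intro y h
    rw [hτ, e.proj_symm_apply' h]
  obtain ⟨V₁, J₁, hV₁, hJ₁, hx₁, hr₁, hW⟩ := isOpen_prod_iff.1 e.open_baseSet _ _ hm
  let u : M × N → H := fun y => Q.str (τ y)
  have hu : ContinuousOn u (V₁ ×ˢ J₁) := Q.str.continuous.comp_continuousOn (hτc.mono hW)
  -- Constancy of the type in the second coordinate is what places `z` in `t(G)`.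
  let z : M × N → H := fun y => (u (y.1, r₀))⁻¹ * u y
  have hz : ContinuousOn z (V₁ ×ˢ J₁) := by
    refine ContinuousOn.mul (ContinuousOn.inv (hu.comp ?_ fun y hy => ⟨hy.1, hr₁⟩)) hu
    exact (continuous_fst.prodMk continuous_const).continuousOn
  have hzr : ∀ y ∈ V₁ ×ˢ J₁, z y ∈ C.t.range := by
    intro y hy
    rw [← QuotientGroup.eq]
    change (QuotientGroup.mk (Q.str (τ (y.1, r₀))) : H ⧸ C.t.range) = QuotientGroup.mk (Q.str (τ y))
    rw [← Q.typeFun_proj, ← Q.typeFun_proj, hpτ _ (hW hy), hpτ (y.1, r₀) (hW ⟨hy.1, hr₁⟩)]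
    exact hQ _ _ _
  let z' : M × N → C.t.range := fun y => if h : z y ∈ C.t.range then ⟨z y, h⟩ else 1
  have hzz : ∀ y ∈ V₁ ×ˢ J₁, (z' y : H) = z y := by
    intro y hy
    simp only [z']
    rw [dif_pos (hzr y hy)]
  have hz' : ContinuousOn z' (V₁ ×ˢ J₁) :=
    Topology.IsInducing.subtypeVal.continuousOn_iff.2 (hz.congr hzz)
  obtain ⟨K, hK, hK1, k, hkc, hk⟩ := C.exists_local_lift hG ht
  have hz1 : z' (x₀, r₀) = 1 := by
    apply Subtype.ext
    rw [hzz _ ⟨hx₁, hr₁⟩]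
    exact inv_mul_cancel _
  obtain ⟨V₂, J₂, hV₂, hJ₂, hx₂, hr₂, hW₂⟩ := isOpen_prod_iff.1
    (hz'.isOpen_inter_preimage (hV₁.prod hJ₁) hK) x₀ r₀
    ⟨⟨hx₁, hr₁⟩, by rw [mem_preimage, hz1]; exact hK1⟩
  have hstr : ∀ y ∈ V₂ ×ˢ J₂, Q.str (MulOpposite.op (k (z' y))⁻¹ • τ y) = u (y.1, r₀) := by
    intro y hy
    rw [Q.str_act, map_inv, hk _ (hW₂ hy).2, hzz y (hW₂ hy).1]
    simp only [z, u]
    group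
  refine ⟨V₂, J₂, hV₂, hJ₂, hx₂, hr₂, fun y => MulOpposite.op (k (z' y))⁻¹ • τ y, ?_, ?_, ?_⟩
  · refine Q.principal.continuous_act.comp_continuousOn (ContinuousOn.prodMk ?_ ?_)
    · exact hτc.mono fun y hy => hW (hW₂ hy).1
    · exact (hkc.comp (hz'.mono fun y hy => (hW₂ hy).1) fun y hy => (hW₂ hy).2).inv
  · intro y hy
    rw [Q.principal.proj_act]
    exact hpτ y (hW (hW₂ hy).1)
  · intro y hy y' hy' h
    rw [hstr y hy, hstr y' hy', h]

/-- Finitely many flat sections cover `{x₀} × I`. They are joined at successive times `t n` over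
shrinking neighbourhoods of `x₀`. -/
theorem exists_isFlatSectionOn_prod_univ
    (hG : HasLocalSections (QuotientGroup.mk : G → G ⧸ C.t.ker))
    (ht : IsHomeomorph (QuotientGroup.quotientKerEquivRange C.t))
    (Q : Bibundle.{uH, uG, _, w} C (M × I))
    (hQ : ∀ x r r', Q.typeFun (x, r) = Q.typeFun (x, r')) (x₀ : M) :
    ∃ V : Set M, IsOpen V ∧ x₀ ∈ V ∧ ∃ τ, Q.IsFlatSectionOn τ (V ×ˢ univ) := by
  choose V J hV hJ hxV hrJ τ hτ using Q.exists_isFlatSectionOn_prod hG ht hQ x₀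
  obtain ⟨t, ht0, htm, ⟨n, hn⟩, htJ⟩ := exists_monotone_Icc_subset_open_cover_unitInterval hJ
    (fun r _ => mem_iUnion.2 ⟨r, hrJ r⟩)
  suffices h : ∀ n, ∃ V : Set M, IsOpen V ∧ x₀ ∈ V ∧
      ∃ τ, Q.IsFlatSectionOn τ (V ×ˢ Icc 0 (t n)) by
    obtain ⟨W, hW, hxW, ρ, hρ⟩ := h n
    refine ⟨W, hW, hxW, ρ, hρ.mono ?_⟩
    rw [hn n le_rfl]
    exact fun y hy => ⟨hy.1, nonneg', le_one'⟩
  intro n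
  induction n with
  | zero =>
    refine ⟨V 0, hV 0, hxV 0, τ 0, (hτ 0).mono ?_⟩
    rw [ht0, Icc_self]
    rintro y ⟨h1, h2⟩
    rw [mem_singleton_iff] at h2
    exact ⟨h1, h2 ▸ hrJ 0⟩
  | succ n ih =>
    obtain ⟨W, hW, hxW, ρ, hρ⟩ := ih
    obtain ⟨i, hi⟩ := htJ n
    have hτ' := (hτ i).mono (prod_mono_right (s := V i) hi)
    have hmid : t n ∈ Icc (t n) (t (n + 1)) := ⟨le_rfl, htm n.le_succ⟩
    -- The correction that matches the next section with `ρ` at time `t n`. It depends only on the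
    -- point of `M`, so it preserves flatness.
    let d : M × I → G := fun y => Q.diff (τ i (y.1, t n), ρ (y.1, t n))
    have hτmid : ∀ x ∈ V i, Q.proj (τ i (x, t n)) = (x, t n) :=
      fun x hx => hτ'.proj_eq (x, t n) ⟨hx, hmid⟩
    have hρmid : ∀ x ∈ W, Q.proj (ρ (x, t n)) = (x, t n) :=
      fun x hx => hρ.proj_eq (x, t n) ⟨hx, nonneg', le_rfl⟩
    have hd : ∀ x ∈ W ∩ V i, MulOpposite.op (d (x, t n)) • τ i (x, t n) = ρ (x, t n) :=
      fun x hx => Q.act_diff ((hτmid x hx.2).trans (hρmid x hx.1).symm)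
    have hp : Continuous fun y : M × I => (y.1, t n) := continuous_fst.prodMk continuous_const
    have hdc : ContinuousOn d ((W ∩ V i) ×ˢ univ) := by
      refine Q.continuousOn_diff.comp (ContinuousOn.prodMk ?_ ?_)
        fun y hy => (hτmid _ hy.1.2).trans (hρmid _ hy.1.1).symm
      · exact hτ'.continuousOn.comp hp.continuousOn fun y hy => ⟨hy.1.2, hmid⟩
      · exact hρ.continuousOn.comp hp.continuousOn fun y hy => ⟨hy.1.1, nonneg', le_rfl⟩
    let σ' : M × I → Q.Total := fun y =>
      if y.2 ≤ t n then ρ y else MulOpposite.op (d y) • τ i y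
    have hσ1 : ∀ y, y.2 ≤ t n → σ' y = ρ y := fun y h => if_pos h
    have hσ2 : ∀ y, ¬ y.2 ≤ t n → σ' y = MulOpposite.op (d y) • τ i y := fun y h => if_neg h
    have hstr : ∀ y ∈ (W ∩ V i) ×ˢ Icc 0 (t (n + 1)), Q.str (σ' y) = Q.str (ρ (y.1, t n)) := by
      intro y hy
      by_cases h : y.2 ≤ t n
      · rw [hσ1 y h]
        exact hρ.str_eq _ ⟨hy.1.1, hy.2.1, h⟩ _ ⟨hy.1.1, nonneg', le_rfl⟩ rfl
      · rw [hσ2 y h, ← hd y.1 hy.1, Q.str_act, Q.str_act]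
        rw [hτ'.str_eq y ⟨hy.1.2, (not_le.1 h).le, hy.2.2⟩ (y.1, t n) ⟨hy.1.2, hmid⟩ rfl]
    refine ⟨W ∩ V i, hW.inter (hV i), ⟨hxW, hxV i⟩, σ', ?_, ?_, ?_⟩
    · refine ContinuousOn.if ?_ ?_ ?_
      · rintro y ⟨hy, hy2⟩
        have h : y.2 = t n := frontier_le_subset_eq continuous_snd continuous_const hy2
        have h2 : y = (y.1, t n) := Prod.ext rfl h
        rw [h2]
        exact (hd y.1 hy.1).symm
      · refine hρ.continuousOn.mono ?_
        rintro y ⟨hy, hy2⟩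
        rw [(isClosed_le continuous_snd continuous_const).closure_eq] at hy2
        exact ⟨hy.1.1, hy.2.1, hy2⟩
      · refine Q.principal.continuous_act.comp_continuousOn (ContinuousOn.prodMk ?_ ?_)
        · refine hτ'.continuousOn.mono ?_
          rintro y ⟨hy, hy2⟩
          refine ⟨hy.1.2, ?_, hy.2.2⟩
          refine closure_minimal (t := {y : M × I | t n ≤ y.2}) (fun z hz => (not_le.1 hz).le)
            (isClosed_le continuous_const continuous_snd) hy2
        · exact hdc.mono fun y hy => ⟨hy.1.1, trivial⟩
    · intro y hy
      by_cases h : y.2 ≤ t n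
      · rw [hσ1 y h]
        exact hρ.proj_eq _ ⟨hy.1.1, hy.2.1, h⟩
      · rw [hσ2 y h, Q.principal.proj_act]
        exact hτ'.proj_eq _ ⟨hy.1.2, (not_le.1 h).le, hy.2.2⟩
    · intro y hy y' hy' h
      rw [hstr y hy, hstr y' hy', h]

/-- Parallel transport to time `1` in a bibundle on `M × I` whose type does not depend on time. -/
theorem exists_transport [T2Space M] [ParacompactSpace M]
    (hG : HasLocalSections (QuotientGroup.mk : G → G ⧸ C.t.ker))
    (ht : IsHomeomorph (QuotientGroup.quotientKerEquivRange C.t))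
    (Q : Bibundle.{uH, uG, _, w} C (M × I))
    (hQ : ∀ x r r', Q.typeFun (x, r) = Q.typeFun (x, r')) :
    ∃ T : C(Q.Total, Q.Total), (∀ p, Q.proj (T p) = ((Q.proj p).1, 1)) ∧
      (∀ p (g : G), T (MulOpposite.op g • p) = MulOpposite.op g • T p) ∧
      ∀ p, Q.str (T p) = Q.str p := by
  classical
  choose V hV hxV τ hτ using Q.exists_isFlatSectionOn_prod_univ hG ht hQ
  obtain ⟨w, hwfin, hwU, hw1⟩ := exists_bumpCovering_unitInterval V hV (fun x => ⟨x, hxV x⟩)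
  let q : Q.Total → M := fun p => (Q.proj p).1
  have hq : Continuous q := continuous_fst.comp Q.proj.continuous
  have hτp : ∀ j p r, q p ∈ V j → Q.proj (τ j (q p, r)) = (q p, r) :=
    fun j p r h => (hτ j).proj_eq _ ⟨h, trivial⟩
  have hτq : ∀ j p, q p ∈ V j → Q.proj (τ j (Q.proj p)) = Q.proj p :=
    fun j p h => (hτ j).proj_eq _ ⟨h, trivial⟩
  -- The move for `j` raises the time to at least `w j`, so it changes nothing where `w j` vanishes.
  let s : M → Q.Total → M × I := fun j p => (q p, (Q.proj p).2 ⊔ w j (q p))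
  have hs : ∀ j, Continuous (s j) := fun j =>
    hq.prodMk ((continuous_snd.comp Q.proj.continuous).sup ((w j).continuous.comp hq))
  -- A point `τ j (x, r) · g` goes to `τ j (x, r ⊔ w j x) · g`.
  let b : M → Q.Total → Q.Total := fun j p =>
    MulOpposite.op (Q.diff (τ j (Q.proj p), p)) • τ j (s j p)
  have hbc : ∀ j, ContinuousOn (b j) (q ⁻¹' V j) := by
    intro j
    refine Q.principal.continuous_act.comp_continuousOn (ContinuousOn.prodMk ?_ ?_)
    · exact (hτ j).continuousOn.comp (hs j).continuousOn fun p hp => ⟨hp, trivial⟩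
    · refine Q.continuousOn_diff.comp (ContinuousOn.prodMk ?_ continuousOn_id) (hτq j)
      exact (hτ j).continuousOn.comp Q.proj.continuous.continuousOn fun p hp => ⟨hp, trivial⟩
  have hbout : ∀ j p, q p ∈ V j → w j (q p) = 0 → b j p = p := by
    intro j p hp h
    have h2 : s j p = Q.proj p := Prod.ext rfl (by simp only [s, h]; exact sup_eq_left.2 nonneg')
    simp only [b, h2]
    exact Q.act_diff (hτq j p hp)
  let a : Q.Total → M → Q.Total := fun p j => if p ∈ q ⁻¹' tsupport (w j) then b j p else p
  have hacont : ∀ j, Continuous fun p => a p j := by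
    intro j
    refine continuous_ite_mem (g := fun p => p) ((hV j).preimage hq)
      ((isClosed_tsupport (w j)).preimage hq) (preimage_mono (hwU j)) (hbc j) continuous_id ?_
    intro p hpV hp
    refine hbout j p hpV ?_
    by_contra h
    refine hp (mem_interior.2 ⟨q ⁻¹' Function.support (w j),
      preimage_mono (subset_tsupport _), ?_, h⟩)
    exact (isOpen_ne.preimage (w j).continuous).preimage hq
  have ha3 : ∀ p j, q p ∈ tsupport (w j) → a p j = b j p := fun p j h => if_pos h
  have ha4 : ∀ p j, q p ∉ tsupport (w j) → a p j = p := fun p j h => if_neg h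
  have hproj : ∀ p j, Q.proj (a p j) = s j p := by
    intro p j
    by_cases h : q p ∈ tsupport (w j)
    · rw [ha3 p j h]
      simp only [b]
      rw [Q.principal.proj_act]
      exact hτp j p _ (hwU j h)
    · rw [ha4 p j h]
      have h0 : w j (q p) = 0 := by
        by_contra h'
        exact h (subset_tsupport _ h')
      exact Prod.ext rfl (by simp only [s, h0]; exact (sup_eq_left.2 nonneg').symm)
  have hstr : ∀ p j, Q.str (a p j) = Q.str p := by
    intro p j
    by_cases h : q p ∈ tsupport (w j)
    · rw [ha3 p j h]
      simp only [b]
      rw [Q.str_act, (hτ j).str_eq (s j p) ⟨hwU j h, trivial⟩ (Q.proj p) ⟨hwU j h, trivial⟩ rfl,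
        ← Q.str_act, Q.act_diff (hτq j p (hwU j h))]
    · rw [ha4 p j h]
  have hact : ∀ p j (g : G), a (MulOpposite.op g • p) j = MulOpposite.op g • a p j := by
    intro p j g
    have hpg : Q.proj (MulOpposite.op g • p) = Q.proj p := Q.principal.proj_act p g
    have hqg : q (MulOpposite.op g • p) = q p := congrArg Prod.fst hpg
    by_cases h : q p ∈ tsupport (w j)
    · rw [ha3 p j h, ha3 _ j (hqg ▸ h)]
      have hd : Q.diff (τ j (Q.proj p), MulOpposite.op g • p) =
          Q.diff (τ j (Q.proj p), p) * g := by
        apply Q.diff_eq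
        rw [MulOpposite.op_mul, mul_smul, Q.act_diff (hτq j p (hwU j h))]
      simp only [b, s, hpg, hqg, hd, MulOpposite.op_mul, mul_smul]
    · rw [ha4 p j h, ha4 _ j (hqg ▸ h)]
  have hqa : ∀ p j, q (a p j) = q p := fun p j =>
    (congrArg Prod.fst (hproj p j) :)
  obtain ⟨l, hl, hlc⟩ := exists_list_continuous_foldl hq hwfin a hacont hqa ha4
  -- Time never decreases along the composite and ends above every weight in the list. Some weight
  -- equals 1 at each point, which forces final time 1.
  have hlproj : ∀ (k : List M) p, q (k.foldl a p) = q p ∧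
      (Q.proj p).2 ≤ (Q.proj (k.foldl a p)).2 ∧
      ∀ j ∈ k, w j (q p) ≤ (Q.proj (k.foldl a p)).2 := by
    intro k
    induction k with
    | nil => exact fun p => ⟨rfl, le_rfl, by simp⟩
    | cons j k ih =>
      intro p
      obtain ⟨h1, h2, h3⟩ := ih (a p j)
      rw [hproj] at h2
      refine ⟨h1.trans (hqa p j), le_sup_left.trans h2, fun i hi => ?_⟩
      rcases List.mem_cons.1 hi with rfl | hi
      · exact le_sup_right.trans h2
      · rw [← hqa p j]
        exact h3 i hi
  refine ⟨⟨fun p => (l (q p)).foldl a p, hlc⟩, ?_, ?_, ?_⟩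
  · intro p
    obtain ⟨h1, -, h3⟩ := hlproj (l (q p)) p
    obtain ⟨j, hj⟩ := hw1 (q p)
    refine Prod.ext h1 (le_antisymm le_one' ?_)
    have hj' : j ∈ l (q p) := (hl _ j).2 (subset_tsupport _ (by
      rw [Function.mem_support, hj]
      exact one_ne_zero))
    exact hj ▸ h3 j hj'
  · intro p g
    have hqg : q (MulOpposite.op g • p) = q p := congrArg Prod.fst (Q.principal.proj_act p g)
    change (l (q (MulOpposite.op g • p))).foldl a _ = _ • (l (q p)).foldl a p
    rw [hqg]
    generalize l (q p) = k
    clear hqg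
    induction k generalizing p with
    | nil => rfl
    | cons j k ih => rw [List.foldl_cons, List.foldl_cons, hact, ih]
  · intro p
    change Q.str ((l (q p)).foldl a p) = _
    generalize l (q p) = k
    induction k generalizing p with
    | nil => rfl
    | cons j k ih => rw [List.foldl_cons, ih, hstr]

end Bibundle

/-! ### Equivariant maps to `E` and the classification -/

namespace Bibundle

variable {C : TopCrossedModule H G} {M : Type uM} [TopologicalSpace M]
  {B : Type uB} [TopologicalSpace B]

/-- A bibundle with an equivariant map over `H` to `E` that covers `f` is the pullback of `E`. -/
theorem nonempty_iso_pullback (P : Bibundle.{uH, uG, uM, max uM uE} C M)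
    (E : Bibundle.{uH, uG, uB, uE} C B) (f : C(M, B)) (F : C(P.Total, E.Total))
    (hf : ∀ p, f (P.proj p) = E.proj (F p))
    (hact : ∀ (p : P.Total) (g : G), F (MulOpposite.op g • p) = MulOpposite.op g • F p)
    (hstr : ∀ p, E.str (F p) = P.str p) : Nonempty (Iso P (pullback f E)) := by
  refine nonempty_iso (Q := pullback f E) ⟨fun p => (⟨(P.proj p, F p), hf p⟩ : PullbackTotal f E),
    (P.proj.continuous.prodMk F.continuous).subtype_mk _⟩ (fun _ => rfl) (fun p g => ?_) hstr
  exact Subtype.ext (Prod.ext (P.principal.proj_act p g) (hact p g))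

/-- The projection of `P` is an open quotient map, so its product with the identity of `S` is still
a quotient map and equivariant families descend. -/
theorem exists_base_map {S : Type*} [TopologicalSpace S] (P : Bibundle.{uH, uG, uM, w} C M)
    (E : Bibundle.{uH, uG, uB, uE} C B) (D : C(S × P.Total, E.Total))
    (hact : ∀ r (p : P.Total) (g : G),
      D (r, MulOpposite.op g • p) = MulOpposite.op g • D (r, p)) :
    ∃ h : C(S × M, B), ∀ r p, h (r, P.proj p) = E.proj (D (r, p)) := by
  have hq : IsQuotientMap (ContinuousMap.prodMap (ContinuousMap.id S) P.proj) :=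
    (IsOpenQuotientMap.id.prodMap P.isOpenQuotientMap_proj).isQuotientMap
  have hD : Function.FactorsThrough (E.proj.comp D)
      (ContinuousMap.prodMap (ContinuousMap.id S) P.proj) := by
    rintro ⟨r, p⟩ ⟨r', p'⟩ h
    obtain rfl : r = r' := congrArg Prod.fst h
    have hp : P.proj p = P.proj p' := congrArg Prod.snd h
    change E.proj (D (r, p)) = E.proj (D (r, p'))
    rw [← P.act_diff hp, hact, E.principal.proj_act]
  refine ⟨hq.lift (E.proj.comp D) hD, fun r p => ?_⟩
  exact congrArg (fun k : C(S × P.Total, B) => k (r, p)) (hq.lift_comp (E.proj.comp D) hD)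

/-- An equivariant homotopy over `H` covers a homotopy over `H / t(G)`. -/
theorem homotopicOver_of_equivariant (P : Bibundle.{uH, uG, uM, w} C M)
    (E : Bibundle.{uH, uG, uB, uE} C B) (D : C(I × P.Total, E.Total))
    (hact : ∀ r (p : P.Total) (g : G),
      D (r, MulOpposite.op g • p) = MulOpposite.op g • D (r, p))
    (hstr : ∀ r p, E.str (D (r, p)) = P.str p) (f₀ f₁ : C(M, B))
    (h₀ : ∀ p, f₀ (P.proj p) = E.proj (D (0, p))) (h₁ : ∀ p, f₁ (P.proj p) = E.proj (D (1, p))) :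
    HomotopicOver E.typeMap f₀ f₁ := by
  obtain ⟨h, hh⟩ := exists_base_map P E D hact
  refine ⟨⟨⟨h, ?_, ?_⟩, ?_⟩⟩
  · intro x
    obtain ⟨p, rfl⟩ := P.proj_surjective x
    exact (hh 0 p).trans (h₀ p).symm
  · intro x
    obtain ⟨p, rfl⟩ := P.proj_surjective x
    exact (hh 1 p).trans (h₁ p).symm
  · intro r x
    obtain ⟨p, rfl⟩ := P.proj_surjective x
    change E.typeFun (h (r, P.proj p)) = E.typeFun (f₀ (P.proj p))
    rw [hh, h₀, E.typeFun_proj, E.typeFun_proj, hstr, hstr]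

theorem exists_nonempty_iso_pullback [T2Space M] [ParacompactSpace M]
    (E : Bibundle.{uH, uG, uB, uE} C B) (hE : IsContractibleOver E.str)
    (P : Bibundle.{uH, uG, uM, max uM uE} C M) :
    ∃ f : C(M, B), Nonempty (Iso P (pullback f E)) := by
  obtain ⟨A, hAc, hAstr, -, hAact, hA1⟩ := exists_equivariant_contraction P E hE
  obtain ⟨-, s, hs, -⟩ := hE
  have hs' : ∀ p, P.str p = E.str (s (P.str p)) := fun p => (hs _).symm
  -- The point `s (P.str p)` only serves to evaluate the end stage. It does not vary equivariantly,
  -- but the end stage is independent of it, so `F` is equivariant.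
  let F : C(P.Total, E.Total) := ⟨fun p => A 1 p (s (P.str p)), hAc.comp
    (continuous_const.prodMk ((continuous_id.prodMk
      (s.continuous.comp P.str.continuous)).subtype_mk hs'))⟩
  have hF : ∀ (p : P.Total) (g : G), F (MulOpposite.op g • p) = MulOpposite.op g • F p := by
    intro p g
    refine Eq.trans ?_ (hAact 1 p (s (P.str p)) g (hs' p))
    refine hA1 _ _ _ (hs' _) ?_
    rw [P.str_act, E.str_act, ← hs' p]
  obtain ⟨f, hf⟩ := exists_base_map P E (F.comp (ContinuousMap.snd : C(Unit × P.Total, P.Total)))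
    (fun _ => hF)
  refine ⟨f.comp ⟨fun x => ((), x), by fun_prop⟩, nonempty_iso_pullback P E _ F
    (fun p => hf () p) hF fun p => hAstr _ _ _ (hs' p)⟩

theorem homotopicOver_of_iso_pullback [T2Space M] [ParacompactSpace M]
    (E : Bibundle.{uH, uG, uB, uE} C B) (hE : IsContractibleOver E.str) {f₀ f₁ : C(M, B)}
    (i : Iso (pullback f₀ E) (pullback f₁ E)) : HomotopicOver E.typeMap f₀ f₁ := by
  let P := pullback f₀ E
  obtain ⟨A, hAc, hAstr, hA0, hAact, hA1⟩ := exists_equivariant_contraction P E hE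
  -- The path `A r p (F p)` deforms any equivariant map `F` over `H` to the end stage, and descends
  -- to a homotopy of base maps.
  have key : ∀ F : C(P.Total, E.Total), (∀ p (g : G),
      F (MulOpposite.op g • p) = MulOpposite.op g • F p) → (∀ p, P.str p = E.str (F p)) →
      ∀ f f' : C(M, B), (∀ p, f (P.proj p) = E.proj (F p)) →
      (∀ p, f' (P.proj p) = E.proj (A 1 p (F p))) → HomotopicOver E.typeMap f f' := by
    intro F hF hstr f f' hf hf'
    refine homotopicOver_of_equivariant P E ⟨fun y => A y.1 y.2 (F y.2), hAc.comp
      (continuous_fst.prodMk ((continuous_snd.prodMk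
        (F.continuous.comp continuous_snd)).subtype_mk fun y => hstr y.2))⟩ ?_ ?_ f f' ?_ hf'
    · intro r p g
      change A r _ (F _) = _ • A r p (F p)
      rw [hF, hAact _ _ _ _ (hstr p)]
    · exact fun r p => hAstr r p _ (hstr p)
    · intro p
      rw [hf]
      exact congrArg E.proj (hA0 p _ (hstr p)).symm
  let F₀ : C(P.Total, E.Total) := pullbackLift f₀ E
  let F₁ : C(P.Total, E.Total) := (pullbackLift f₁ E).comp ⟨i.toHomeo, i.toHomeo.continuous⟩
  have hF₀ : ∀ p (g : G), F₀ (MulOpposite.op g • p) = MulOpposite.op g • F₀ p := fun _ _ => rfl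
  have hF₁ : ∀ p (g : G), F₁ (MulOpposite.op g • p) = MulOpposite.op g • F₁ p := by
    intro p g
    exact congrArg (pullbackLift f₁ E) (i.map_act p g)
  have hs₀ : ∀ p, P.str p = E.str (F₀ p) := fun _ => rfl
  have hs₁ : ∀ p, P.str p = E.str (F₁ p) := fun p => (i.str_eq p).symm
  -- The end stage is the same for `F₀` and `F₁`, so the map `f` it covers is homotopic to both `f₀`
  -- and `f₁`.
  let D : C(Unit × P.Total, E.Total) := ⟨fun y => A 1 y.2 (F₀ y.2), hAc.comp
      (continuous_const.prodMk ((continuous_snd.prodMk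
        (F₀.continuous.comp continuous_snd)).subtype_mk fun y => hs₀ y.2))⟩
  obtain ⟨h, hh⟩ := exists_base_map P E D (fun _ p g => hAact _ _ _ g (hs₀ p))
  let f : C(M, B) := h.comp ⟨fun x => ((), x), by fun_prop⟩
  have h₀ : HomotopicOver E.typeMap f₀ f :=
    key F₀ hF₀ hs₀ f₀ f (fun p => p.2) (fun p => hh () p)
  have h₁ : HomotopicOver E.typeMap f₁ f := by
    refine key F₁ hF₁ hs₁ f₁ f (fun p => ?_) (fun p => ?_)
    · exact (congrArg f₁ (i.proj_eq p)).symm.trans (i.toHomeo p).2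
    · exact (hh () p).trans (congrArg E.proj (hA1 p _ _ (hs₀ p) (hs₁ p)))
  exact (homotopicOverSetoid M E.typeMap).trans h₀ ((homotopicOverSetoid M E.typeMap).symm h₁)

theorem nonempty_iso_pullback_of_homotopicOver [T2Space M] [ParacompactSpace M]
    (hG : HasLocalSections (QuotientGroup.mk : G → G ⧸ C.t.ker))
    (ht : IsHomeomorph (QuotientGroup.quotientKerEquivRange C.t))
    (E : Bibundle.{uH, uG, uB, uE} C B) {f₀ f₁ : C(M, B)} (h : HomotopicOver E.typeMap f₀ f₁) :
    Nonempty (Iso (pullback f₀ E) (pullback f₁ E)) := by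
  obtain ⟨h⟩ := h
  have hprop : ∀ r x, E.typeFun (h (r, x)) = E.typeFun (f₀ x) := fun r x => h.prop r x
  let k : C(M × I, B) := ⟨fun y => h (y.2, y.1), h.continuous.comp continuous_swap⟩
  have hk0 : ∀ x, k (x, 0) = f₀ x := h.apply_zero
  have hk1 : ∀ x, k (x, 1) = f₁ x := h.apply_one
  have htype : ∀ y, (pullback k E).typeFun y = E.typeFun (k y) := by
    intro y
    obtain ⟨p, rfl⟩ := (pullback k E).proj_surjective y
    rw [typeFun_proj]
    have h2 : k ((pullback k E).proj p) = E.proj p.1.2 := p.2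
    rw [h2, typeFun_proj]
    rfl
  obtain ⟨T, hTp, hTa, hTs⟩ := exists_transport hG ht (pullback k E) (fun x r r' => by
    rw [htype, htype]
    exact (hprop r x).trans (hprop r' x).symm)
  -- The inclusion of `f₀^* E` as the part of `k^* E` at time 0. Transport then carries it to time
  -- 1, over `f₁`.
  let i : (pullback f₀ E).Total → (pullback k E).Total := fun p =>
    (⟨((p.1.1, 0), p.1.2), (hk0 _).trans p.2⟩ : PullbackTotal k E)
  have hi : Continuous i := by
    refine Continuous.subtype_mk (Continuous.prodMk (Continuous.prodMk ?_ continuous_const) ?_) _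
    · exact (pullbackProj f₀ E).continuous
    · exact (pullbackLift f₀ E).continuous
  refine nonempty_iso_pullback (pullback f₀ E) E f₁
    ((pullbackLift k E).comp (T.comp ⟨i, hi⟩)) ?_ ?_ ?_
  · intro p
    rw [← hk1]
    have h2 : k ((pullback k E).proj (T (i p))) = E.proj (T (i p)).1.2 := (T (i p)).2
    rw [hTp] at h2
    exact h2
  · intro p g
    exact congrArg (pullbackLift k E) (hTa (i p) g)
  · exact fun p => hTs (i p)

end Bibundle

end

theorem mainTheorem1
    {H : Type uH} {G : Type uG} [Group H] [TopologicalSpace H] [IsTopologicalGroup H]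
    [Group G] [TopologicalSpace G] [IsTopologicalGroup G]
    (C : TopCrossedModule H G)
    (hG : HasLocalSections (QuotientGroup.mk : G → G ⧸ C.t.ker))
    (hH : HasLocalSections (QuotientGroup.mk : H → H ⧸ C.t.range))
    (ht : IsHomeomorph (QuotientGroup.quotientKerEquivRange C.t))
    {B : Type uB} [TopologicalSpace B] (E : Bibundle.{uH, uG, uB, uE} C B)
    (hE : IsContractibleOver E.str)
    (M : Type uM) [TopologicalSpace M] [T2Space M] [ParacompactSpace M] :
    ∃ Φ : HomotopyClassesOver M E.typeMap → Bibundle.IsoClasses.{uH, uG, uM, max uM uE} C M,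
      (∀ f : C(M, B), Φ (Quotient.mk _ f) = Quotient.mk _ (Bibundle.pullback f E)) ∧
      Function.Bijective Φ := by
  refine ⟨Quotient.lift (fun f => Quotient.mk _ (Bibundle.pullback f E)) fun f₀ f₁ h =>
    Quotient.sound (Bibundle.nonempty_iso_pullback_of_homotopicOver hG ht E h), fun _ => rfl,
    ?_, ?_⟩
  · rintro ⟨f₀⟩ ⟨f₁⟩ h
    obtain ⟨i⟩ := Quotient.exact h
    exact Quotient.sound (Bibundle.homotopicOver_of_iso_pullback E hE i)
  · rintro ⟨P⟩
    obtain ⟨f, hf⟩ := Bibundle.exists_nonempty_iso_pullback E hE P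
    exact ⟨Quotient.mk _ f, (Quotient.sound hf).symm⟩
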